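/- Let $A$ be a finite alphabet and $u=u_0u_1u_2\cdots\in A^{\mathbb N}$ an infinite word. Let $S$ be the shift on $A^{\mathbb N}$ and $X=\overline{\{S^nu : n\in\mathbb N\}}$ the subshift generated by $u$ ($A^{\mathbb N}$ has the product topology, $X$ its Borel $\sigma$-algebra). Write $(e_a)_{a\in A}$ for the canonical basis of $\mathbb Z^A$ and $\mathrm{Ab}(v)=(|v|_a)_{a\in A}\in\mathbb Z^A$ for the vector counting the occurrences of each letter in a finite word $v$. Put $$D_u=\{\mathrm{Ab}(v): v \text{ a finite prefix of } u\},\qquad D_{u,a}=\{\mathrm{Ab}(v): va \text{ a finite prefix of } u\},$$ and let $\Gamma_0$ be the subgroup of $\mathbb Z^A$ generated by the vectors $e_a-e_b$, $a,b\in A$. Let $\pi$ be a linear projection of $\mathbb R^A$ onto a hyperplane $\mathcal P$ (a linear subspace of codimension one), and let $\lambda$ be the Lebesgue measure of $\mathcal P$. Assume that - $\pi(\mathbb Z^A)$ is dense in $\mathcal P$; - $\pi(D_u)$ is bounded; - $(X,S)$ is minimal; - for every $a\in A$ the boundary in $\mathcal P$ of $\overline{\pi(D_{u,a})}$ has zero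 Lebesgue measure; - the sets $\overline{\pi(D_{u,a})}$, $a\in A$, whose union is $\overline{\pi(D_u)}$, are pairwise disjoint in Lebesgue measure: $\lambda(\overline{\pi(D_{u,a})}\cap\overline{\pi(D_{u,b})})=0$ for $a\ne b$. On the quotient $\mathcal P/\pi(\Gamma_0)$, let $T$ be the translation by $\pi(e_a)$ (the same map for all $a\in A$), and let $\bar\lambda$ be the normalised Lebesgue (Haar) measure, which is a probability measure. Then there are an $S$-invariant Borel probability measure $\mu$ on $X$ and a map $\varphi:X\to\mathcal P/\pi(\Gamma_0)$ such that: 1. $\varphi$ is a topological semi-conjugacy from $(X,S)$ onto $(\mathcal P/\pi(\Gamma_0),T)$, that is, $\varphi$ is continuous and surjective and $\varphi\circ S=T\circ\varphi$; 2. $\varphi$ makes $(X,S,\mu)$ a finite extension of $(\mathcal P/\pi(\Gamma_0),T,\bar\lambda)$, that is, $T$ preserves $\bar\lambda$, $\varphi_*\mu=\bar\lambda$, and there is an integer $k\ge1$ such that $\varphi^{-1}(y)$ has exactly $k$ elements for $\bar\lambda$-almost every $y$. If moreover the translates $\overline{\pi(D_u)}+t$, $t\in\pi(\Gamma_0)$,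 are pairwise disjoint in Lebesgue measure, then: 3. $(X,S)$ is uniquely ergodic (so $\mu$ is its only invariant Borel probability measure); 4. $(X,S,\mu)$ is isomorphic, modulo null sets, to the measure-preserving system $(\mathcal P/\pi(\Gamma_0),T,\bar\lambda)$; 5. $(X,S,\mu)$ is isomorphic, modulo null sets, to the measure-preserving system given by the domain exchange $E$ on $\overline{\pi(D_u)}$ with normalised Lebesgue measure, where $E(x)=x+\pi(e_a)$ if $a$ is the only letter with $x\in\overline{\pi(D_{u,a})}$ (this defines $E$ almost everywhere). -/

import Mathlib

open MeasureTheory Set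

noncomputable section

/-! ### Notions from dynamics -/

/-- A dynamical system is minimal if every (forward) orbit is dense. -/
def IsMinimalSystem {X : Type*} [TopologicalSpace X] (S : X → X) : Prop :=
  ∀ x : X, Dense (range fun n : ℕ => S^[n] x)

/-- `φ` is a topological semi-conjugacy from `(X, S)` onto `(Y, T)`. -/
structure IsTopSemiconjugacy {X Y : Type*} [TopologicalSpace X] [TopologicalSpace Y]
    (S : X → X) (T : Y → Y) (φ : X → Y) : Prop where
  continuous : Continuous φ
  surjective : Function.Surjective φ
  semiconj : ∀ x, φ (S x) = T (φ x)

/-- `φ` presents `(X, S, μ)` as a finite extension of `(Y, T, ν)`: it is a factor map of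
measure-preserving systems, and for some `k ≥ 1` almost every point has exactly `k` preimages. -/
structure IsFiniteExtension {X Y : Type*} [MeasurableSpace X] [MeasurableSpace Y]
    (S : X → X) (μ : Measure X) (T : Y → Y) (ν : Measure Y) (φ : X → Y) : Prop where
  source : MeasurePreserving S μ μ
  target : MeasurePreserving T ν ν
  map : MeasurePreserving φ μ ν
  semiconj : ∀ᵐ x ∂μ, φ (S x) = T (φ x)
  fibres : ∃ k : ℕ, 1 ≤ k ∧ ∀ᵐ y ∂ν, (φ ⁻¹' {y}).encard = k

/-- The measure-preserving systems `(X, S, μ)` and `(Y, T, ν)` are isomorphic (modulo null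
sets). -/
def MeasurablyIsomorphic {X Y : Type*} [MeasurableSpace X] [MeasurableSpace Y]
    (S : X → X) (μ : Measure X) (T : Y → Y) (ν : Measure Y) : Prop :=
  MeasurePreserving S μ μ ∧ MeasurePreserving T ν ν ∧
  ∃ (φ : X → Y) (ψ : Y → X), MeasurePreserving φ μ ν ∧ MeasurePreserving ψ ν μ ∧
    (∀ᵐ x ∂μ, ψ (φ x) = x) ∧ (∀ᵐ y ∂ν, φ (ψ y) = y) ∧ (∀ᵐ x ∂μ, φ (S x) = T (φ x))

/-- There is exactly one invariant probability measure. -/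
def IsUniquelyErgodic {X : Type*} [MeasurableSpace X] (S : X → X) : Prop :=
  ∃! ν : Measure X, IsProbabilityMeasure ν ∧ MeasurePreserving S ν ν

/-! ### Subshift generated by an infinite word -/

/-- The shift on infinite words. -/
def shift {A : Type*} (w : ℕ → A) : ℕ → A := fun i => w (i + 1)

/-- The closure of the orbit of `u` under the shift. -/
def subshift {A : Type*} [TopologicalSpace A] (u : ℕ → A) : Set (ℕ → A) :=
  closure (range fun n : ℕ => shift^[n] u)

theorem continuous_shift {A : Type*} [TopologicalSpace A] :
    Continuous (shift : (ℕ → A) → ℕ → A) :=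
  continuous_pi fun i => continuous_apply (i + 1)

theorem shift_mem_subshift {A : Type*} [TopologicalSpace A] (u : ℕ → A) :
    MapsTo shift (subshift u) (subshift u) := by
  refine MapsTo.closure ?_ continuous_shift
  rintro _ ⟨n, rfl⟩
  exact ⟨n + 1, Function.iterate_succ_apply' shift n u⟩

/-- The shift acting on the subshift generated by `u`. -/
def subshiftMap {A : Type*} [TopologicalSpace A] (u : ℕ → A) : subshift u → subshift u :=
  (shift_mem_subshift u).restrict

/-! ### Discrete line of an infinite word and its projection -/

section DiscreteLine

variable {A : Type*} [DecidableEq A]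

/-- The abelianisation of a finite word: the vector of numbers of occurrences. -/
def abelianVector (v : List A) : A → ℤ := fun a => (v.count a : ℤ)

/-- The canonical basis vector `e_a` of `ℤ^A`. -/
def basisVec (a : A) : A → ℤ := Pi.single a 1

/-- The prefix of length `n` of an infinite word. -/
def wordPrefix (u : ℕ → A) (n : ℕ) : List A := (List.range n).map u

/-- `D_u`: the abelianisations of the finite prefixes of `u`. -/
def discreteLine (u : ℕ → A) : Set (A → ℤ) :=
  {x | ∃ n : ℕ, x = abelianVector (wordPrefix u n)}

/-- `D_{u,a}`: the abelianisations of the finite words `v` such that `va` is a prefix of `u`. -/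
def discretePiece (u : ℕ → A) (a : A) : Set (A → ℤ) :=
  {x | ∃ (v : List A) (n : ℕ), v ++ [a] = wordPrefix u n ∧ x = abelianVector v}

/-- The subgroup `Γ₀` of `ℤ^A` generated by the differences `e_a - e_b`. -/
def Gamma0 (A : Type*) [DecidableEq A] : AddSubgroup (A → ℤ) :=
  AddSubgroup.closure {x | ∃ a b : A, x = basisVec a - basisVec b}

theorem abelianVector_append_singleton (v : List A) (a : A) :
    abelianVector (v ++ [a]) = abelianVector v + basisVec a := by
  ext b
  by_cases h : b = a
  · subst h; simp [abelianVector, basisVec]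
  · simp [abelianVector, basisVec, h, Ne.symm h]

variable [Fintype A] {P : Submodule ℝ (EuclideanSpace ℝ A)}

/-- The restriction to `ℤ^A` of a linear map `π : ℝ^A → P`. -/
def intProj (π : EuclideanSpace ℝ A →ₗ[ℝ] P) : (A → ℤ) →+ P where
  toFun x := π (WithLp.toLp 2 fun a => (x a : ℝ))
  map_zero' := by
    rw [← map_zero π]; congr 1; ext a; simp
  map_add' x y := by
    rw [← map_add π]; congr 1; ext a; simp

/-- The closure of `π(D_u)` in the hyperplane. -/
def tile (π : EuclideanSpace ℝ A →ₗ[ℝ] P) (u : ℕ → A) : Set P :=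
  closure (intProj π '' discreteLine u)

/-- The closure of `π(D_{u,a})` in the hyperplane. -/
def tilePiece (π : EuclideanSpace ℝ A →ₗ[ℝ] P) (u : ℕ → A) (a : A) : Set P :=
  closure (intProj π '' discretePiece u a)

/-- The subgroup `π(Γ₀)` of the hyperplane. -/
def projGamma0 (π : EuclideanSpace ℝ A →ₗ[ℝ] P) : AddSubgroup P :=
  (Gamma0 A).map (intProj π)

theorem add_mem_tile (π : EuclideanSpace ℝ A →ₗ[ℝ] P) (u : ℕ → A) (a : A) {x : P}
    (hx : x ∈ tilePiece π u a) : x + intProj π (basisVec a) ∈ tile π u := by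
  have h : MapsTo (fun y : P => y + intProj π (basisVec a))
      (intProj π '' discretePiece u a) (intProj π '' discreteLine u) := by
    rintro _ ⟨_, ⟨v, n, hv, rfl⟩, rfl⟩
    refine ⟨abelianVector (v ++ [a]), ⟨n, by rw [hv]⟩, ?_⟩
    rw [abelianVector_append_singleton, map_add]
  exact h.closure (continuous_add_const _) hx

open Classical in
/-- The domain exchange on the closure of `π(D_u)`: translation by `π(e_a)` at the points that
lie in the closure of `π(D_{u,a})` for exactly one letter `a`; points lying in several pieces (a
null set when the pieces are disjoint in measure) are left fixed, by convention. -/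
def domainExchange (π : EuclideanSpace ℝ A →ₗ[ℝ] P) (u : ℕ → A) (x : tile π u) : tile π u :=
  if h : ∃! a : A, (x : P) ∈ tilePiece π u a then
    ⟨x + intProj π (basisVec h.choose), add_mem_tile π u h.choose h.choose_spec.1⟩
  else x

/-- Lebesgue measure on the hyperplane, restricted to the closure of `π(D_u)` and normalised to
be a probability measure. -/
def tileMeasure (π : EuclideanSpace ℝ A →ₗ[ℝ] P) (u : ℕ → A) : Measure (tile π u) :=
  (volume (tile π u))⁻¹ • (volume : Measure P).comap Subtype.val

/-! ### The torus `P / π(Γ₀)` -/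

/-- The quotient group `P / π(Γ₀)`, with its quotient topology and Borel `σ`-algebra. -/
def ProjTorus (π : EuclideanSpace ℝ A →ₗ[ℝ] P) : Type _ := P ⧸ projGamma0 π

instance (π : EuclideanSpace ℝ A →ₗ[ℝ] P) : AddCommGroup (ProjTorus π) :=
  inferInstanceAs (AddCommGroup (P ⧸ projGamma0 π))

instance (π : EuclideanSpace ℝ A →ₗ[ℝ] P) : TopologicalSpace (ProjTorus π) :=
  inferInstanceAs (TopologicalSpace (P ⧸ projGamma0 π))

instance (π : EuclideanSpace ℝ A →ₗ[ℝ] P) : IsTopologicalAddGroup (ProjTorus π) :=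
  inferInstanceAs (IsTopologicalAddGroup (P ⧸ projGamma0 π))

instance (π : EuclideanSpace ℝ A →ₗ[ℝ] P) : LocallyCompactSpace (ProjTorus π) :=
  inferInstanceAs (LocallyCompactSpace (P ⧸ projGamma0 π))

instance (π : EuclideanSpace ℝ A →ₗ[ℝ] P) : MeasurableSpace (ProjTorus π) := borel _

instance (π : EuclideanSpace ℝ A →ₗ[ℝ] P) : BorelSpace (ProjTorus π) := ⟨rfl⟩

/-- The quotient homomorphism from the hyperplane to the torus. -/
def torusMk (π : EuclideanSpace ℝ A →ₗ[ℝ] P) : P →+ ProjTorus π :=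
  QuotientAddGroup.mk' (projGamma0 π)

/-- The translation by `π(e_a)` on `P / π(Γ₀)`. -/
def torusTranslation (π : EuclideanSpace ℝ A →ₗ[ℝ] P) (a : A) (x : ProjTorus π) : ProjTorus π :=
  x + torusMk π (intProj π (basisVec a))

/-- The normalised Lebesgue (i.e. Haar) measure on the torus `P / π(Γ₀)`. -/
def torusMeasure (π : EuclideanSpace ℝ A →ₗ[ℝ] P) : Measure (ProjTorus π) :=
  ((Measure.addHaar : Measure (ProjTorus π)) univ)⁻¹ • Measure.addHaar

end DiscreteLine

end

/-!
Since `π(D_u)` is bounded, the Gottschalk–Hedlund theorem gives a continuous position map `g` from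
the subshift to `P` with `g u = 0` and `g (S x) = g x + π(e_{x₀})`. Its image is the tile, and it
sends a point with first letter `a` into the piece of `a`. Discard the null set of positions having
a translate by `π(ℤ^A)` in two different pieces: for the others the pieces visited spell the word,
so `g` is almost everywhere injective, and the normalised measure of the tile lifts to a
shift-invariant measure that makes `g` an isomorphism with the domain exchange.

Boundedness also makes `π(Γ₀)` a lattice. Modulo `π(Γ₀)` the increments `π(e_a)` coincide, so `g`
induces a semi-conjugacy onto a translation of the torus, which is uniquely ergodic because its
orbits are dense. The cardinality of a generic fibre does not increase along this translation, so
ergodicity makes it almost everywhere constant. If the translates of the tile do not overlap, the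
map to the torus is almost everywhere injective and carries unique ergodicity back to the subshift.
-/

noncomputable section

open Filter Topology Function Bornology

/-! ### Minimal systems and bounded cocycles -/

namespace IsMinimalSystem

variable {X : Type*} [TopologicalSpace X] {S : X → X}

theorem eq_univ_of_isClosed (hmin : IsMinimalSystem S) {s : Set X} (hs : IsClosed s)
    (hne : s.Nonempty) (hinv : MapsTo S s s) : s = univ := by
  obtain ⟨x, hx⟩ := hne
  rw [← hs.closure_eq, ← dense_iff_closure_eq]
  exact (hmin x).mono (range_subset_iff.2 fun n => hinv.iterate n hx)

theorem surjective [CompactSpace X] [T2Space X] (hmin : IsMinimalSystem S) (hS : Continuous S) :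
    Surjective S := by
  rw [← range_eq_univ, ← image_univ]
  cases isEmpty_or_nonempty X with
  | inl _ => exact Subsingleton.elim _ _
  | inr _ =>
    exact hmin.eq_univ_of_isClosed (isCompact_univ.image hS).isClosed (univ_nonempty.image S)
      fun x _ => mem_image_of_mem S (mem_univ x)

end IsMinimalSystem

/-- `M` is a minimal set of `F`: it is minimal among the nonempty closed forward-invariant sets. -/
def IsMinimalSet {Z : Type*} [TopologicalSpace Z] (F : Z → Z) (M : Set Z) : Prop :=
  Minimal (fun s => IsClosed s ∧ s.Nonempty ∧ MapsTo F s s) M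

namespace IsMinimalSet

variable {Z : Type*} [TopologicalSpace Z] {F : Z → Z} {K M : Set Z}

theorem exists_subset (hK : IsCompact K) (hKc : IsClosed K) (hKne : K.Nonempty)
    (hKF : MapsTo F K K) : ∃ M ⊆ K, IsMinimalSet F M := by
  let 𝒮 : Set (Set Z) := {s | s ⊆ K ∧ IsClosed s ∧ s.Nonempty ∧ MapsTo F s s}
  have hsInter : ∀ c ⊆ 𝒮, IsChain (· ⊆ ·) c → c.Nonempty → ⋂₀ c ∈ 𝒮 := by
    intro c hc hchain hcne
    have := hcne.to_subtype
    refine ⟨(sInter_subset_of_mem hcne.some_mem).trans (hc hcne.some_mem).1,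
      isClosed_sInter fun s hs => (hc hs).2.1, ?_, fun x hx s hs => (hc hs).2.2.2 (hx s hs)⟩
    exact IsCompact.nonempty_sInter_of_directed_nonempty_isCompact_isClosed
      (IsChain.directedOn hchain.symm) (fun s hs => (hc hs).2.2.1)
      (fun s hs => hK.of_isClosed_subset (hc hs).2.1 (hc hs).1) (fun s hs => (hc hs).2.1)
  obtain ⟨M, -, hM⟩ := zorn_superset_nonempty 𝒮
    (fun c hc hc' hne => ⟨_, hsInter c hc hc' hne, fun s hs => sInter_subset_of_mem hs⟩) K
    ⟨Subset.rfl, hKc, hKne, hKF⟩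
  exact ⟨M, hM.prop.1, hM.prop.2, fun N hN hNM => hM.le_of_le ⟨hNM.trans hM.prop.1, hN⟩ hNM⟩

theorem mapsTo_of_commute (hM : IsMinimalSet F M) {G : Z → Z} (hG : Continuous G)
    (hFG : Function.Commute F G) {z : Z} (hz : z ∈ M) (hGz : G z ∈ M) : MapsTo G M M := by
  obtain ⟨hMc, -, hMF⟩ := hM.prop
  have hinv : MapsTo F (M ∩ G ⁻¹' M) (M ∩ G ⁻¹' M) := fun y hy =>
    ⟨hMF hy.1, by simpa only [mem_preimage, ← hFG y] using hMF hy.2⟩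
  exact fun y hy => (hM.le_of_le ⟨hMc.inter (hMc.preimage hG), ⟨z, hz, hGz⟩, hinv⟩
    inter_subset_left hy).2

end IsMinimalSet

/-- The skew product over `S` with cocycle `f`; over a single orbit its second coordinate records
the Birkhoff sums of `f`. -/
def skewProduct {X E : Type*} [Add E] (S : X → X) (f : X → E) (p : X × E) : X × E :=
  (S p.1, p.2 + f p.1)

theorem iterate_skewProduct {X E : Type*} [AddCommMonoid E] (S : X → X) (f : X → E) (n : ℕ)
    (p : X × E) : (skewProduct S f)^[n] p = (S^[n] p.1, p.2 + birkhoffSum S f n p.1) := by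
  induction n with
  | zero => simp
  | succ n ih => simp only [iterate_succ_apply', ih, skewProduct, birkhoffSum_succ, add_assoc]

theorem commute_skewProduct_add_right {X E : Type*} [AddCommMonoid E] (S : X → X) (f : X → E)
    (δ : E) : Function.Commute (skewProduct S f) (Prod.map id (· + δ)) := fun p =>
  Prod.ext rfl (add_right_comm p.2 δ (f p.1))

theorem eq_zero_of_isBounded_range_add_nsmul {E : Type*} [NormedAddCommGroup E] [NormedSpace ℝ E]
    {s δ : E} (hb : IsBounded (range fun n : ℕ => s + n • δ)) : δ = 0 := by
  obtain ⟨C, hC⟩ := hb.exists_norm_le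
  by_contra hδ
  obtain ⟨n, hn⟩ := exists_nat_gt ((C + ‖s‖) / ‖δ‖)
  rw [div_lt_iff₀ (norm_pos_iff.2 hδ)] at hn
  have hnorm : ‖n • δ‖ = n * ‖δ‖ := by simp [RCLike.norm_nsmul ℝ]
  have htri : ‖n • δ‖ ≤ ‖s + n • δ‖ + ‖s‖ := by simpa using norm_sub_le (s + n • δ) s
  linarith [hC _ (mem_range_self n)]

/-- If `M` meets a vertical fibre in two points, then it is invariant under their difference. -/
theorem IsMinimalSet.eq_of_mem_of_mem {X E : Type*} [TopologicalSpace X] [NormedAddCommGroup E]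
    [NormedSpace ℝ E] {S : X → X} {f : X → E} {M : Set (X × E)}
    (hM : IsMinimalSet (skewProduct S f) M) (hb : IsBounded (Prod.snd '' M)) {x : X} {s t : E}
    (hs : (x, s) ∈ M) (ht : (x, t) ∈ M) : s = t := by
  have hinv : MapsTo (Prod.map id (· + (t - s))) M M :=
    hM.mapsTo_of_commute (by fun_prop) (commute_skewProduct_add_right S f _) hs (by simpa using ht)
  have hmem (n : ℕ) : (x, s + n • (t - s)) ∈ M := by
    simpa [Prod.map_iterate] using hinv.iterate n hs
  refine (sub_eq_zero.1 (eq_zero_of_isBounded_range_add_nsmul (s := s) (hb.subset ?_))).symm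
  exact range_subset_iff.2 fun n => ⟨_, hmem n, rfl⟩

theorem exists_continuous_mem_of_isCompact {X Y : Type*} [TopologicalSpace X] [T2Space X]
    [TopologicalSpace Y] {M : Set (X × Y)} (hM : IsCompact M) (hex : ∀ x, ∃ y, (x, y) ∈ M)
    (huniq : ∀ x y y', (x, y) ∈ M → (x, y') ∈ M → y = y') :
    ∃ g : X → Y, Continuous g ∧ ∀ x, (x, g x) ∈ M := by
  choose g hg using hex
  refine ⟨g, continuous_iff_isClosed.2 fun C hC => ?_, hg⟩
  have himage : g ⁻¹' C = Prod.fst '' (M ∩ Prod.snd ⁻¹' C) := by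
    ext x
    constructor
    · exact fun hx => ⟨(x, g x), ⟨hg x, hx⟩, rfl⟩
    · rintro ⟨⟨_, y⟩, ⟨hy, hyC⟩, rfl⟩
      exact (huniq _ _ _ hy (hg _) ▸ hyC :)
  rw [himage]
  exact ((hM.inter_right (hC.preimage continuous_snd)).image continuous_fst).isClosed

/-- Gottschalk–Hedlund: a minimal set of the skew product, taken inside the closure of a bounded
orbit, is the graph of the required function. -/
theorem IsMinimalSystem.exists_continuous_coboundary {X E : Type*} [TopologicalSpace X]
    [CompactSpace X] [T2Space X] [NormedAddCommGroup E] [NormedSpace ℝ E] [ProperSpace E]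
    {S : X → X} (hmin : IsMinimalSystem S) (hS : Continuous S) {f : X → E} (hf : Continuous f)
    {x₀ : X} (hb : IsBounded (range fun n => birkhoffSum S f n x₀)) :
    ∃ g : X → E, Continuous g ∧ ∀ x, g (S x) = g x + f x := by
  set F := skewProduct S f
  set K : Set (X × E) := closure (range fun n => F^[n] (x₀, 0))
  have hF : Continuous F := by unfold F skewProduct; fun_prop
  have hKsub : K ⊆ univ ×ˢ closure (range fun n => birkhoffSum S f n x₀) := by
    refine closure_minimal (range_subset_iff.2 fun n => ?_) (isClosed_univ.prod isClosed_closure)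
    simpa [F, iterate_skewProduct] using subset_closure (mem_range_self n)
  have hK : IsCompact K :=
    (isCompact_univ.prod hb.isCompact_closure).of_isClosed_subset isClosed_closure hKsub
  have hKF : MapsTo F K K := by
    refine MapsTo.closure ?_ hF
    rintro _ ⟨n, rfl⟩
    exact ⟨n + 1, iterate_succ_apply' F n _⟩
  obtain ⟨M, hMK, hM⟩ := IsMinimalSet.exists_subset hK isClosed_closure
    (range_nonempty _).closure hKF
  obtain ⟨hMc, hMne, hMF⟩ := hM.prop
  have hMcomp : IsCompact M := hK.of_isClosed_subset hMc hMK
  have huniq (x s t) (hs : (x, s) ∈ M) (ht : (x, t) ∈ M) : s = t :=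
    hM.eq_of_mem_of_mem (hMcomp.image continuous_snd).isBounded hs ht
  have hfst : Prod.fst '' M = univ :=
    hmin.eq_univ_of_isClosed (hMcomp.image continuous_fst).isClosed (hMne.image _)
      (mapsTo_image_iff.2 fun p hp => ⟨F p, hMF hp, rfl⟩)
  have hex (x : X) : ∃ s, (x, s) ∈ M := by
    simpa using eq_univ_iff_forall.1 hfst x
  obtain ⟨g, hg, hgM⟩ := exists_continuous_mem_of_isCompact hMcomp hex huniq
  exact ⟨g, hg, fun x => huniq _ _ _ (hgM (S x)) (hMF (hgM x))⟩

/-! ### Rotations of compact groups -/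

section Rotation

variable {G : Type*} [AddCommGroup G] [TopologicalSpace G] [IsTopologicalAddGroup G]
  [CompactSpace G] [T2Space G] [SecondCountableTopology G] [MeasurableSpace G] [BorelSpace G]

theorem isClosed_setOf_map_add_right_eq (ν : Measure G) [IsFiniteMeasure ν] :
    IsClosed {t : G | ν.map (· + t) = ν} := by
  let := TopologicalSpace.metrizableSpaceMetric G
  have hset : {t : G | ν.map (· + t) = ν} =
      ⋂ f : BoundedContinuousFunction G ℝ, {t | ∫ x, f (x + t) ∂ν = ∫ x, f x ∂ν} := by
    ext t
    have hmap (f : BoundedContinuousFunction G ℝ) :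
        ∫ x, f x ∂ν.map (· + t) = ∫ x, f (x + t) ∂ν :=
      integral_map (measurable_add_const t).aemeasurable f.continuous.aestronglyMeasurable
    simp only [mem_iInter, mem_ofPred, ← hmap]
    exact ⟨fun h f => by rw [h], ext_of_forall_integral_eq_of_IsFiniteMeasure⟩
  rw [hset]
  refine isClosed_iInter fun f => isClosed_eq ?_ continuous_const
  simpa only [setIntegral_univ] using continuous_parametric_integral_of_continuous (μ := ν)
    (f := fun t x : G => f (x + t)) (by fun_prop) isCompact_univ

theorem isAddLeftInvariant_of_denseRange_nsmul {α : G} (hα : DenseRange fun n : ℕ => n • α)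
    {ν : Measure G} [IsFiniteMeasure ν] (hν : MeasurePreserving (· + α) ν ν) :
    ν.IsAddLeftInvariant := by
  have hmem (n : ℕ) : n • α ∈ {t : G | ν.map (· + t) = ν} := by
    simpa [add_right_iterate] using (hν.iterate n).map_eq
  have huniv : {t : G | ν.map (· + t) = ν} = univ := by
    rw [← (isClosed_setOf_map_add_right_eq ν).closure_eq, ← dense_iff_closure_eq]
    exact hα.mono (range_subset_iff.2 hmem)
  refine ⟨fun t => ?_⟩
  have ht : ν.map (· + t) = ν := eq_univ_iff_forall.1 huniv t
  simpa only [add_comm t] using ht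

variable {m : Measure G} [IsProbabilityMeasure m] [m.IsAddHaarMeasure]

theorem eq_of_measurePreserving_add_right {α : G} (hα : DenseRange fun n : ℕ => n • α)
    {ν : Measure G} [IsProbabilityMeasure ν] (hν : MeasurePreserving (· + α) ν ν) : ν = m := by
  have := isAddLeftInvariant_of_denseRange_nsmul hα hν
  have : ν.IsAddHaarMeasure := Measure.isAddHaarMeasure_of_isCompact_nonempty_interior ν univ
    isCompact_univ (by simp) (by simp) (by simp)
  exact Measure.isAddHaarMeasure_eq_of_isProbabilityMeasure ν m

theorem measurePreserving_of_semiconj_add_right {X : Type*} [MeasurableSpace X] {S : X → X}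
    {α : G} (hα : DenseRange fun n : ℕ => n • α) {ν : Measure X} [IsProbabilityMeasure ν]
    {φ : X → G} (hφ : Measurable φ) (hS : MeasurePreserving S ν ν)
    (hsemi : ∀ᵐ x ∂ν, φ (S x) = φ x + α) : MeasurePreserving φ ν m := by
  have := Measure.isProbabilityMeasure_map (μ := ν) hφ.aemeasurable
  refine ⟨hφ, eq_of_measurePreserving_add_right hα ⟨measurable_add_const α, ?_⟩⟩
  calc (ν.map φ).map (· + α) = ν.map (φ ∘ S) := by
        rw [Measure.map_map (measurable_add_const α) hφ]
        exact (Measure.map_congr hsemi).symm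
    _ = ν.map φ := by rw [← Measure.map_map hφ hS.measurable, hS.map_eq]

end Rotation

/-! ### Measurable inverses -/

/-- The sections are constant off `t`, so their preimages of closed sets are, up to the measurable
set `tᶜ`, images of closed sets. -/
theorem exists_measurable_invOn {X Y : Type*} [TopologicalSpace X] [MeasurableSpace X]
    [BorelSpace X] [Nonempty X] [TopologicalSpace Y] [MeasurableSpace Y] [BorelSpace Y]
    {g : X → Y} (hg : IsClosedMap g) {t : Set Y} (ht : MeasurableSet t)
    (hsurj : ∀ y ∈ t, ∃ x, g x = y) (hinj : InjOn g (g ⁻¹' t)) :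
    ∃ ψ : Y → X, Measurable ψ ∧ InvOn ψ g (g ⁻¹' t) t := by
  classical
  choose! s hs using hsurj
  let ψ : Y → X := t.piecewise s fun _ => Classical.arbitrary X
  have hright : RightInvOn ψ g t := fun y hy => by
    simp only [ψ, piecewise_eq_of_mem _ _ _ hy, hs y hy]
  have hinv : InvOn ψ g (g ⁻¹' t) t :=
    ⟨fun x hx => hinj (by rwa [mem_preimage, hright hx]) hx (hright hx), hright⟩
  refine ⟨ψ, measurable_of_isClosed fun C hC => ?_, hinv⟩
  have himage : ψ ⁻¹' C ∩ t = g '' C ∩ t := by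
    ext y
    refine and_congr_left fun hy => ⟨fun hyC => ⟨ψ y, hyC, hright hy⟩, ?_⟩
    rintro ⟨x, hx, rfl⟩
    rwa [mem_preimage, hinv.1 hy]
  have hconst : ψ ⁻¹' C ∩ tᶜ = {_y | Classical.arbitrary X ∈ C} ∩ tᶜ := by
    ext y
    exact and_congr_left fun hy => by
      simp only [ψ, mem_preimage, piecewise_eq_of_notMem _ _ _ hy, mem_ofPred]
  rw [← inter_union_compl (ψ ⁻¹' C) t, himage, hconst]
  exact ((hg C hC).measurableSet.inter ht).union ((MeasurableSet.const _).inter ht.compl)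

section InvOn

variable {X Y : Type*} [MeasurableSpace X] [MeasurableSpace Y] {g : X → Y} {ψ : Y → X}
  {μ : Measure X} {m : Measure Y} {t : Set Y}

theorem measurePreserving_map_of_rightInvOn (hg : Measurable g) (hψ : Measurable ψ)
    (hinv : RightInvOn ψ g t) (ht : ∀ᵐ y ∂m, y ∈ t) : MeasurePreserving g (m.map ψ) m := by
  have hae : g ∘ ψ =ᵐ[m] id := ht.mono hinv
  exact ⟨hg, by rw [Measure.map_map hg hψ, Measure.map_congr hae, Measure.map_id]⟩

theorem measurePreserving_of_leftInvOn (hg : MeasurePreserving g μ m) (hψ : Measurable ψ)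
    (hinv : LeftInvOn ψ g (g ⁻¹' t)) (ht : ∀ᵐ y ∂m, y ∈ t) : MeasurePreserving ψ m μ := by
  have hae : ψ ∘ g =ᵐ[μ] id := (hg.quasiMeasurePreserving.ae ht).mono fun x hx => hinv hx
  refine ⟨hψ, ?_⟩
  rw [← hg.map_eq, Measure.map_map hψ hg.measurable, Measure.map_congr hae, Measure.map_id]

theorem measurablyIsomorphic_of_invOn {S : X → X} {T : Y → Y} (hS : Measurable S)
    (hT : MeasurePreserving T m m) (hg : MeasurePreserving g μ m) (hψ : Measurable ψ)
    (hinv : InvOn ψ g (g ⁻¹' t) t) (ht : ∀ᵐ y ∂m, y ∈ t) (hST : ∀ᵐ x ∂μ, g (S x) = T (g x)) :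
    MeasurablyIsomorphic S μ T m := by
  have hψm := measurePreserving_of_leftInvOn hg hψ hinv.1 ht
  have hconj : ψ ∘ T ∘ g =ᵐ[μ] S := by
    filter_upwards [hST, (hT.comp hg).quasiMeasurePreserving.ae ht] with x hx hxt
    rw [comp_apply, comp_apply, ← hx, hinv.1 (by rwa [mem_preimage, hx])]
  have hSμ : MeasurePreserving S μ μ :=
    ⟨hS, by rw [← Measure.map_congr hconj, (hψm.comp (hT.comp hg)).map_eq]⟩
  exact ⟨hSμ, hT, g, ψ, hg, hψm, (hg.quasiMeasurePreserving.ae ht).mono fun x hx => hinv.1 hx,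
    ht.mono hinv.2, hST⟩

end InvOn

/-! ### Fibres of homomorphisms with countable kernel -/

theorem exists_ae_eq_const_of_comp_ae_le {Y β : Type*} [MeasurableSpace Y] {T : Y → Y}
    {m : Measure Y} [IsFiniteMeasure m] (hT : Ergodic T m) [Nonempty β] [LinearOrder β]
    [TopologicalSpace β] [OrderTopology β] [SecondCountableTopology β] [MeasurableSpace β]
    [OpensMeasurableSpace β] {c : Y → β} (hc : AEMeasurable c m) (hle : c ∘ T ≤ᵐ[m] c) :
    ∃ k, ∀ᵐ y ∂m, c y = k := by
  have : HasCountableSeparatingOn β (· ∈ range Ici) univ := .range_Ici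
  refine exists_eventuallyEq_const_of_forall_separating (· ∈ range Ici) ?_
  rintro _ ⟨k, rfl⟩
  have hpre : T ⁻¹' (c ⁻¹' Ici k) ≤ᵐ[m] c ⁻¹' Ici k := hle.mono fun y hy hk => le_trans hk hy
  rcases hT.ae_empty_or_univ_of_preimage_ae_le (hc.nullMeasurable measurableSet_Ici) hpre
    with h | h
  · exact .inr (measure_eq_zero_iff_ae_notMem.1 (ae_eq_empty.1 h))
  · exact .inl (eventuallyEq_univ.1 h)

section CountableKernel

variable {E G : Type*} [AddCommGroup E] [AddCommGroup G] {p : E →+ G}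

theorem preimage_image_eq_iUnion_add_ker (p : E →+ G) (N : Set E) :
    p ⁻¹' (p '' N) = ⋃ γ : p.ker, (· + (γ : E)) ⁻¹' N := by
  ext x
  simp only [mem_preimage, mem_image, mem_iUnion]
  constructor
  · rintro ⟨y, hy, hyx⟩
    exact ⟨⟨y - x, by rw [AddMonoidHom.mem_ker, map_sub, hyx, sub_self]⟩, by simpa using hy⟩
  · rintro ⟨γ, hγ⟩
    exact ⟨_, hγ, by rw [map_add, γ.2, add_zero]⟩

theorem encard_inter_fiber_eq (p : E →+ G) (R : Set E) (x : E) :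
    (R ∩ p ⁻¹' {p x}).encard = {γ : p.ker | x + (γ : E) ∈ R}.encard := by
  have himage : (fun γ : p.ker => x + (γ : E)) '' {γ | x + γ ∈ R} = R ∩ p ⁻¹' {p x} := by
    ext y
    constructor
    · rintro ⟨γ, hγ, rfl⟩
      exact ⟨hγ, by rw [mem_preimage, map_add, γ.2, add_zero, mem_singleton_iff]⟩
    · rintro ⟨hy, hyx⟩
      refine ⟨⟨y - x, ?_⟩, by simpa using hy, by simp⟩
      rw [AddMonoidHom.mem_ker, map_sub, mem_singleton_iff.1 hyx, sub_self]
  have hinj : Injective fun γ : p.ker => x + (γ : E) := fun _ _ h => Subtype.ext (add_left_cancel h)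
  rw [← himage, hinj.encard_image]

variable [MeasurableSpace E] [MeasurableAdd E]

theorem measure_preimage_image_eq_zero [Countable p.ker] {μ : Measure E} [μ.IsAddRightInvariant]
    {N : Set E} (hN : μ N = 0) : μ (p ⁻¹' (p '' N)) = 0 := by
  simp only [preimage_image_eq_iUnion_add_ker, measure_iUnion_null_iff, measure_preimage_add_right,
    hN, implies_true]

variable [MeasurableSpace G]

theorem measure_eq_zero_of_measure_preimage_eq_zero [MeasurableAdd₂ G] (hp : Measurable p)
    (hsurj : Surjective p) {μ : Measure E} [SFinite μ] [NeZero μ] [μ.IsAddLeftInvariant]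
    {m : Measure G} [SFinite m] [m.IsAddRightInvariant] {M : Set G} (hM : MeasurableSet M)
    (h : μ (p ⁻¹' M) = 0) : m M = 0 := by
  have hmeas : MeasurableSet {q : E × G | q.2 + p q.1 ∈ M} :=
    (measurable_snd.add (hp.comp measurable_fst)) hM
  have hslice (y : G) : μ {x | y + p x ∈ M} = 0 := by
    obtain ⟨z, rfl⟩ := hsurj y
    have hz := (measure_preimage_add μ z (p ⁻¹' M)).trans h
    simp only [preimage_preimage, map_add] at hz
    exact hz
  have hprod : (μ.prod m) {q : E × G | q.2 + p q.1 ∈ M} = 0 := by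
    rw [Measure.prod_apply_symm hmeas]
    exact lintegral_eq_zero_of_ae_eq_zero (.of_forall hslice)
  obtain ⟨x, hx⟩ := ((Measure.measure_prod_null hmeas).1 hprod).exists
  exact (measure_preimage_add_right m (p x) M).symm.trans hx

variable [StandardBorelSpace E] [MeasurableSpace.CountablySeparated G] [Countable p.ker]

theorem measurableSet_image_of_countable_ker (hp : Measurable p) (hsurj : Surjective p) {N : Set E}
    (hN : MeasurableSet N) : MeasurableSet (p '' N) := by
  rw [← hp.measurableSet_preimage_iff_of_surjective hsurj, preimage_image_eq_iUnion_add_ker]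
  exact .iUnion fun γ => measurable_add_const _ hN

theorem measure_image_eq_zero_of_countable_ker [MeasurableAdd₂ G] (hp : Measurable p)
    (hsurj : Surjective p) {μ : Measure E} [SFinite μ] [NeZero μ] [μ.IsAddLeftInvariant]
    {m : Measure G} [SFinite m] [m.IsAddRightInvariant] {N : Set E} (hN : μ N = 0) :
    m (p '' N) = 0 := by
  have hM : μ (toMeasurable μ N) = 0 := by rwa [measure_toMeasurable]
  refine measure_mono_null (image_mono (subset_toMeasurable μ N)) ?_
  exact measure_eq_zero_of_measure_preimage_eq_zero hp hsurj
    (measurableSet_image_of_countable_ker hp hsurj (measurableSet_toMeasurable μ N))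
    (measure_preimage_image_eq_zero hM)

/-- Pulled back to `E`, the cardinality is the counting measure of a section of a measurable subset
of `E × p.ker`. -/
theorem measurable_encard_inter_fiber (hp : Measurable p)
    (hsurj : Surjective p) {R : Set E} (hR : MeasurableSet R) :
    Measurable fun y => (R ∩ p ⁻¹' {y}).encard := by
  have hcount (x : E) : ((R ∩ p ⁻¹' {p x}).encard : ENNReal) =
      Measure.count {γ : p.ker | x + (γ : E) ∈ R} := by
    rw [Measure.count_apply (to_countable _).measurableSet, encard_inter_fiber_eq]
  have hmeas : Measurable fun x => Measure.count {γ : p.ker | x + (γ : E) ∈ R} :=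
    measurable_measure_prodMk_left (s := {q : E × p.ker | q.1 + (q.2 : E) ∈ R})
      (measurable_from_prod_countable_left (f := fun q : E × p.ker => q.1 + (q.2 : E))
        (fun γ => measurable_add_const (γ : E)) hR)
  refine measurable_to_countable' fun n => ?_
  rw [← hp.measurableSet_preimage_iff_of_surjective hsurj]
  convert hmeas (measurableSet_singleton (n : ENNReal)) using 1
  ext x
  simp [← hcount]

end CountableKernel

/-! ### Piecewise translations -/

theorem measurePreserving_of_le_measure_preimage {Y : Type*} [MeasurableSpace Y] {E : Y → Y}
    {m : Measure Y} [IsFiniteMeasure m] (hE : Measurable E)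
    (h : ∀ s, MeasurableSet s → m s ≤ m (E ⁻¹' s)) : MeasurePreserving E m m := by
  refine ⟨hE, (Measure.eq_of_le_of_measure_univ_eq (Measure.le_iff.2 fun s hs => ?_) ?_).symm⟩
  · rw [Measure.map_apply hE hs]
    exact h s hs
  · rw [Measure.map_apply hE MeasurableSet.univ, preimage_univ]

theorem measure_le_of_ae_le_iUnion_image_add {G ι : Type*} [AddGroup G] [MeasurableSpace G]
    [MeasurableAdd G] {m : Measure G} [m.IsAddRightInvariant] [Countable ι] {B : ι → Set G}
    (hB : ∀ i, MeasurableSet (B i)) (hdisj : Pairwise (Disjoint on B)) (v : ι → G) {s s' : Set G}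
    (hs' : MeasurableSet s') (h : s ≤ᵐ[m] ⋃ i, (· + v i) '' (B i ∩ s')) : m s ≤ m s' :=
  calc m s ≤ m (⋃ i, (· + v i) '' (B i ∩ s')) := measure_mono_ae h
    _ ≤ ∑' i, m ((· + v i) '' (B i ∩ s')) := measure_iUnion_le _
    _ = ∑' i, m (B i ∩ s') := by simp only [image_add_right, measure_preimage_add_right]
    _ = m (⋃ i, B i ∩ s') := (measure_iUnion
        (fun i j hij => (hdisj hij).mono inter_subset_left inter_subset_left)
        fun i => (hB i).inter hs').symm
    _ ≤ m s' := measure_mono (iUnion_subset fun _ => inter_subset_right)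

/-! ### Prefixes of an infinite word -/

section Words

variable {A : Type*}

theorem wordPrefix_succ (u : ℕ → A) (n : ℕ) :
    wordPrefix u (n + 1) = wordPrefix u n ++ [u n] := by
  simp only [wordPrefix, List.range_succ, List.map_append, List.map_cons, List.map_nil]

theorem shift_iterate_apply (u : ℕ → A) (n i : ℕ) : (shift^[n] u) i = u (i + n) := by
  induction n generalizing u with
  | zero => rfl
  | succ n ih => rw [iterate_succ_apply, ih, shift, add_assoc]

variable [DecidableEq A]

theorem abelianVector_wordPrefix_succ (u : ℕ → A) (n : ℕ) :
    abelianVector (wordPrefix u (n + 1)) = abelianVector (wordPrefix u n) + basisVec (u n) := by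
  rw [wordPrefix_succ, abelianVector_append_singleton]

theorem discreteLine_eq_range (u : ℕ → A) :
    discreteLine u = range fun n => abelianVector (wordPrefix u n) := by
  ext x
  simp only [discreteLine, mem_ofPred, mem_range, eq_comm]

theorem mem_discretePiece {u : ℕ → A} {a : A} {x : A → ℤ} :
    x ∈ discretePiece u a ↔ ∃ n, u n = a ∧ x = abelianVector (wordPrefix u n) := by
  constructor
  · rintro ⟨v, n, hv, rfl⟩
    cases n with
    | zero => exact absurd hv (List.append_ne_nil_of_right_ne_nil v (List.cons_ne_nil a []))
    | succ n =>
      rw [wordPrefix_succ] at hv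
      obtain ⟨rfl, h⟩ := List.append_inj' hv rfl
      exact ⟨n, (List.head_eq_of_cons_eq h).symm, rfl⟩
  · rintro ⟨n, rfl, rfl⟩
    exact ⟨_, n + 1, (wordPrefix_succ u n).symm, rfl⟩

theorem iUnion_discretePiece (u : ℕ → A) : ⋃ a, discretePiece u a = discreteLine u := by
  ext x
  simp only [discreteLine_eq_range, mem_iUnion, mem_discretePiece, mem_range]
  exact ⟨fun ⟨_, n, _, hx⟩ => ⟨n, hx.symm⟩, fun ⟨n, hx⟩ => ⟨u n, n, rfl, hx.symm⟩⟩

variable [Fintype A]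

theorem sum_basisVec (a : A) : ∑ b, basisVec a b = 1 := by
  simp only [basisVec, Finset.sum_pi_single', Finset.mem_univ, if_true]

theorem sum_abelianVector_wordPrefix (u : ℕ → A) (n : ℕ) :
    ∑ b, abelianVector (wordPrefix u n) b = n := by
  induction n with
  | zero => exact Finset.sum_const_zero
  | succ n ih =>
    simp only [abelianVector_wordPrefix_succ, Pi.add_apply, Finset.sum_add_distrib, ih,
      sum_basisVec, Nat.cast_succ]

end Words

/-! ### The lattice `π(Γ₀)` -/

section Lattice

variable {A : Type*} {P : Submodule ℝ (EuclideanSpace ℝ A)} {π : EuclideanSpace ℝ A →ₗ[ℝ] P}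

theorem intProj_apply (z : A → ℤ) : intProj π z = π (WithLp.toLp 2 fun a => (z a : ℝ)) := rfl

theorem surjective_of_denseRange_intProj [Finite A] (hdense : DenseRange (intProj π)) :
    Surjective π := by
  have := Fintype.ofFinite A
  have hrange : Dense (LinearMap.range π : Set P) :=
    hdense.mono (range_subset_iff.2 fun z => ⟨_, rfl⟩)
  rw [← LinearMap.range_eq_top, ← Submodule.dense_iff_topologicalClosure_eq_top.1 hrange]
  exact (LinearMap.range π).closed_of_finiteDimensional.submodule_topologicalClosure_eq.symm

/-- The sum of the coordinates. It is unbounded along the prefixes of an infinite word, which is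
what keeps `ker π` transverse to the differences `e_a - e_b`. -/
def coordSum (A : Type*) [Fintype A] : EuclideanSpace ℝ A →ₗ[ℝ] ℝ where
  toFun x := ∑ a, x a
  map_add' x y := by simp only [PiLp.add_apply, Finset.sum_add_distrib]
  map_smul' c x := by simp only [PiLp.smul_apply, Finset.smul_sum, RingHom.id_apply]

theorem coordSum_apply [Fintype A] (x : EuclideanSpace ℝ A) : coordSum A x = ∑ a, x a := rfl

variable [DecidableEq A]

theorem intProj_basisVec (a : A) : intProj π (basisVec a) = π (EuclideanSpace.single a 1) := by
  rw [intProj_apply]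
  congr 1
  ext b
  simp [basisVec, Pi.single_apply]

/-- The vectors `π(e_a - e_{a₀})`, `a ≠ a₀`: they generate `π(Γ₀)`, and form a basis of the
hyperplane when `π(D_u)` is bounded. -/
def letterDiff (π : EuclideanSpace ℝ A →ₗ[ℝ] P) (a₀ : A) (a : {a : A // a ≠ a₀}) : P :=
  intProj π (basisVec a.1) - intProj π (basisVec a₀)

theorem sub_basisVec_mem {σ : Type*} [SetLike σ P] [AddSubgroupClass σ P] {H : σ} {a₀ : A}
    (hH : range (letterDiff π a₀) ⊆ H) (a : A) :
    intProj π (basisVec a) - intProj π (basisVec a₀) ∈ H := by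
  by_cases ha : a = a₀
  · rw [ha, sub_self]
    exact zero_mem H
  · exact hH ⟨⟨a, ha⟩, rfl⟩

theorem projGamma0_eq_closure (π : EuclideanSpace ℝ A →ₗ[ℝ] P) (a₀ : A) :
    projGamma0 π = AddSubgroup.closure (range (letterDiff π a₀)) := by
  rw [projGamma0, Gamma0, AddMonoidHom.map_closure]
  refine le_antisymm ((AddSubgroup.closure_le _).2 ?_) ((AddSubgroup.closure_le _).2 ?_)
  · rintro _ ⟨_, ⟨a, b, rfl⟩, rfl⟩
    rw [map_sub, ← sub_sub_sub_cancel_right _ _ (intProj π (basisVec a₀))]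
    exact sub_mem (sub_basisVec_mem AddSubgroup.subset_closure a)
      (sub_basisVec_mem AddSubgroup.subset_closure b)
  · rintro _ ⟨a, rfl⟩
    exact AddSubgroup.subset_closure ⟨_, ⟨a.1, a₀, rfl⟩, map_sub _ _ _⟩

variable [Fintype A]

theorem intProj_eq_sum (z : A → ℤ) : intProj π z = ∑ a, z a • intProj π (basisVec a) := by
  simp only [← map_zsmul, ← map_sum]
  congr 1
  ext b
  simp [basisVec, Pi.single_apply, Finset.sum_apply]

theorem exists_ker_coordSum_ne_zero {u : ℕ → A} (hπ : Surjective π)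
    (hbdd : IsBounded (intProj π '' discreteLine u)) : ∃ w, π w = 0 ∧ coordSum A w ≠ 0 := by
  by_contra! h
  obtain ⟨s, hs⟩ := π.exists_rightInverse_of_surjective (LinearMap.range_eq_top.2 hπ)
  let ℓ : P →ₗ[ℝ] ℝ := coordSum A ∘ₗ s
  have hfactor (x : EuclideanSpace ℝ A) : ℓ (π x) = coordSum A x := by
    have hker : π (s (π x) - x) = 0 := by
      rw [map_sub, sub_eq_zero]
      exact LinearMap.congr_fun hs (π x)
    exact sub_eq_zero.1 ((map_sub (coordSum A) _ _).symm.trans (h _ hker))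
  have hvertex (n : ℕ) : ℓ (intProj π (abelianVector (wordPrefix u n))) = n := by
    simp only [intProj_apply, hfactor, coordSum_apply]
    exact_mod_cast sum_abelianVector_wordPrefix u n
  obtain ⟨C, hC⟩ := (ℓ.toContinuousLinearMap.lipschitz.isBounded_image hbdd).exists_norm_le
  obtain ⟨n, hn⟩ := exists_nat_gt C
  have hle := hC _ ⟨_, ⟨_, ⟨n, rfl⟩, rfl⟩, rfl⟩
  rw [LinearMap.coe_toContinuousLinearMap', hvertex, Real.norm_natCast] at hle
  exact hn.not_ge hle

theorem span_range_letterDiff (hπ : Surjective π) {w : EuclideanSpace ℝ A} (hw : π w = 0)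
    (hw0 : coordSum A w ≠ 0) (a₀ : A) : Submodule.span ℝ (range (letterDiff π a₀)) = ⊤ := by
  refine eq_top_iff.2 fun p _ => ?_
  obtain ⟨q, rfl⟩ := hπ p
  let x : EuclideanSpace ℝ A := q - (coordSum A q / coordSum A w) • w
  have hx : π q = π x := by rw [map_sub, map_smul, hw, smul_zero, sub_zero]
  have hx0 : ∑ a, x a = 0 := by
    rw [← coordSum_apply, map_sub, map_smul, smul_eq_mul, div_mul_cancel₀ _ hw0, sub_self]
  have hsum : π x = ∑ a, x a • (intProj π (basisVec a) - intProj π (basisVec a₀)) := by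
    simp only [smul_sub, Finset.sum_sub_distrib]
    rw [← Finset.sum_smul, hx0, zero_smul, sub_zero]
    simp only [intProj_basisVec, ← map_smul]
    rw [← map_sum]
    congr 1
    ext b
    simp [Finset.sum_apply, Pi.single_apply]
  rw [hx, hsum]
  exact Submodule.sum_mem _ fun a _ =>
    Submodule.smul_mem _ _ (sub_basisVec_mem Submodule.subset_span a)

theorem exists_basis_projGamma0 {u : ℕ → A} (hP : Module.finrank ℝ P + 1 = Fintype.card A)
    (hπ : Surjective π) (hbdd : IsBounded (intProj π '' discreteLine u)) (a₀ : A) :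
    ∃ b : Module.Basis {a : A // a ≠ a₀} ℝ P,
      projGamma0 π = (Submodule.span ℤ (range b)).toAddSubgroup := by
  obtain ⟨w, hw, hw0⟩ := exists_ker_coordSum_ne_zero hπ hbdd
  have hcard : Fintype.card {a : A // a ≠ a₀} = Module.finrank ℝ P := by
    rw [Fintype.card_subtype_compl, Fintype.card_subtype_eq, ← hP, Nat.add_sub_cancel]
  refine ⟨basisOfTopLeSpanOfCardEqFinrank _ (span_range_letterDiff hπ hw hw0 a₀).ge hcard, ?_⟩
  rw [coe_basisOfTopLeSpanOfCardEqFinrank, Submodule.span_int_eq_addSubgroupClosure,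
    projGamma0_eq_closure]

end Lattice

/-! ### The torus `P / π(Γ₀)` -/

section Torus

variable {A : Type*} [DecidableEq A] {P : Submodule ℝ (EuclideanSpace ℝ A)}
  (π : EuclideanSpace ℝ A →ₗ[ℝ] P)

theorem continuous_torusMk : Continuous (torusMk π) := continuous_quot_mk

theorem surjective_torusMk : Surjective (torusMk π) :=
  QuotientAddGroup.mk'_surjective (projGamma0 π)

theorem ker_torusMk : (torusMk π).ker = projGamma0 π := QuotientAddGroup.ker_mk' (projGamma0 π)

theorem torusMk_eq_zero {x : P} : torusMk π x = 0 ↔ x ∈ projGamma0 π := by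
  rw [← AddMonoidHom.mem_ker, ker_torusMk]

theorem torusMk_basisVec (a b : A) :
    torusMk π (intProj π (basisVec a)) = torusMk π (intProj π (basisVec b)) := by
  rw [← sub_eq_zero, ← map_sub, torusMk_eq_zero, ← map_sub]
  exact ⟨_, AddSubgroup.subset_closure ⟨a, b, rfl⟩, rfl⟩

theorem isOpenMap_torusMk [Finite A] : IsOpenMap (torusMk π) := by
  have := Fintype.ofFinite A
  exact QuotientAddGroup.isOpenMap_coe

instance [Finite A] : SecondCountableTopology (ProjTorus π) := by
  have := Fintype.ofFinite A
  exact ((isOpenMap_torusMk π).isQuotientMap (continuous_torusMk π)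
    (surjective_torusMk π)).secondCountableTopology (isOpenMap_torusMk π)

instance [Finite A] : Countable (projGamma0 π) :=
  ((to_countable _).image (intProj π)).to_subtype

instance [Finite A] : Countable (torusMk π).ker :=
  ker_torusMk π ▸ inferInstance

variable {π}

theorem torusMk_intProj [Fintype A] (a : A) (z : A → ℤ) :
    torusMk π (intProj π z) = (∑ b, z b) • torusMk π (intProj π (basisVec a)) := by
  rw [intProj_eq_sum, map_sum, Finset.sum_smul]
  exact Finset.sum_congr rfl fun b _ => by rw [map_zsmul, torusMk_basisVec π b a]

section Lattice

variable {ι : Type*} (b : Module.Basis ι ℝ P)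
  (hb : projGamma0 π = (Submodule.span ℤ (range b)).toAddSubgroup)
include hb

theorem t2Space_projTorus [Finite A] [Finite ι] : T2Space (ProjTorus π) := by
  have := Fintype.ofFinite A
  have : IsClosed (projGamma0 π : Set P) := by
    rw [hb]
    exact AddSubgroup.isClosed_of_discrete
  exact inferInstanceAs (T2Space (P ⧸ projGamma0 π))

theorem compactSpace_projTorus [Finite A] [Finite ι] : CompactSpace (ProjTorus π) := by
  have := Fintype.ofFinite A
  have := Fintype.ofFinite ι
  have himage : torusMk π '' closure (ZSpan.fundamentalDomain b) = univ := by
    refine eq_univ_of_forall fun y => ?_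
    obtain ⟨x, rfl⟩ := surjective_torusMk π y
    refine ⟨ZSpan.fract b x, subset_closure (ZSpan.fract_mem_fundamentalDomain b x), ?_⟩
    rw [ZSpan.fract_apply, map_sub, sub_eq_self, torusMk_eq_zero, hb]
    exact (ZSpan.floor b x).2
  exact ⟨himage ▸ (ZSpan.fundamentalDomain_isBounded b).isCompact_closure.image
    (continuous_torusMk π)⟩

theorem finite_inter_fiber_torusMk [Finite A] [Finite ι] {s : Set P} (hs : IsBounded s)
    (y : ProjTorus π) : (s ∩ torusMk π ⁻¹' {y}).Finite := by
  have := Fintype.ofFinite A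
  obtain ⟨x, rfl⟩ := surjective_torusMk π y
  have hfin : ((· - x) '' s ∩ projGamma0 π).Finite := by
    rw [hb]
    exact ZSpan.setFinite_inter b ((IsometryEquiv.subRight x).isometry.lipschitz.isBounded_image hs)
  refine (hfin.preimage (sub_left_injective (b := x)).injOn).subset fun p hp => ?_
  refine ⟨mem_image_of_mem _ hp.1, ?_⟩
  rw [SetLike.mem_coe, ← torusMk_eq_zero, map_sub, hp.2, sub_self]

end Lattice

variable [CompactSpace (ProjTorus π)]

theorem denseRange_nsmul_torusMk [Finite A] (hdense : DenseRange (intProj π)) (a : A) :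
    DenseRange fun n : ℕ => n • torusMk π (intProj π (basisVec a)) := by
  have := Fintype.ofFinite A
  rw [← denseRange_zsmul_iff_nsmul]
  refine ((surjective_torusMk π).denseRange.comp hdense (continuous_torusMk π)).mono ?_
  rintro _ ⟨z, rfl⟩
  exact ⟨∑ b, z b, (torusMk_intProj a z).symm⟩

variable [Fintype A]

instance : IsProbabilityMeasure (torusMeasure π) :=
  ⟨by rw [torusMeasure, Measure.smul_apply, smul_eq_mul,
    ENNReal.inv_mul_cancel (NeZero.ne _) (measure_ne_top _ _)]⟩

instance : (torusMeasure π).IsAddHaarMeasure :=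
  .smul _ (ENNReal.inv_ne_zero.2 (measure_ne_top _ _)) (ENNReal.inv_ne_top.2 (NeZero.ne _))

theorem ergodic_torusTranslation (hdense : DenseRange (intProj π)) (a : A) :
    Ergodic (torusTranslation π a) (torusMeasure π) :=
  (funext fun x => add_comm _ x : (_ + ·) = torusTranslation π a) ▸
    ergodic_add_left_of_denseRange_nsmul (denseRange_nsmul_torusMk hdense a) (torusMeasure π)

end Torus

/-! ### The tile and its overlaps -/

section Tile

variable {A : Type*} [DecidableEq A] {P : Submodule ℝ (EuclideanSpace ℝ A)}
  {π : EuclideanSpace ℝ A →ₗ[ℝ] P} {u : ℕ → A}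

theorem measurableSet_tile [Finite A] : MeasurableSet (tile π u) :=
  have := Fintype.ofFinite A
  isClosed_closure.measurableSet

theorem measurableSet_tilePiece [Finite A] (a : A) : MeasurableSet (tilePiece π u a) :=
  have := Fintype.ofFinite A
  isClosed_closure.measurableSet

theorem tilePiece_subset_tile (a : A) : tilePiece π u a ⊆ tile π u :=
  closure_mono (image_mono (iUnion_discretePiece u ▸ subset_iUnion _ a))

theorem iUnion_tilePiece [Finite A] : ⋃ a, tilePiece π u a = tile π u := by
  simp only [tilePiece, tile, ← iUnion_discretePiece, image_iUnion, closure_iUnion_of_finite]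

theorem isCompact_tile [Finite A] (hbdd : IsBounded (intProj π '' discreteLine u)) :
    IsCompact (tile π u) := by
  have := Fintype.ofFinite A
  exact hbdd.isCompact_closure

variable (π u) in
/-- The points lying in two different pieces of the tile. -/
def pieceOverlap : Set P :=
  ⋃ a : A, ⋃ b : A, ⋃ _ : a ≠ b, tilePiece π u a ∩ tilePiece π u b

variable (π u) in
/-- The points that a translation by an element of `π(ℤ^A)` sends to two different pieces. Off this
set, which is invariant under these translations, every point of an orbit of the domain exchange
lies in a single piece. -/
def singularSet : Set P := ⋃ z : A → ℤ, (· + intProj π z) ⁻¹' pieceOverlap π u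

variable (π u) in
/-- The points lying both in the tile and in another of its translates by `π(Γ₀)`. -/
def translateOverlap : Set P :=
  ⋃ γ : projGamma0 π, ⋃ _ : γ ≠ 0, tile π u ∩ (· + (γ : P)) '' tile π u

theorem eq_of_mem_tilePiece {a b : A} {p : P} (hp : p ∉ pieceOverlap π u)
    (ha : p ∈ tilePiece π u a) (hb : p ∈ tilePiece π u b) : a = b := by
  by_contra hab
  exact hp (mem_iUnion₂.2 ⟨a, b, mem_iUnion.2 ⟨hab, ha, hb⟩⟩)

theorem pairwise_disjoint_sdiff_pieceOverlap :
    Pairwise (Disjoint on fun a => tilePiece π u a \ pieceOverlap π u) := fun _ _ hab =>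
  disjoint_left.2 fun _ ha hb => hab (eq_of_mem_tilePiece ha.2 ha.1 hb.1)

theorem pieceOverlap_subset_singularSet : pieceOverlap π u ⊆ singularSet π u := fun p hp =>
  mem_iUnion.2 ⟨0, by rwa [mem_preimage, map_zero, add_zero]⟩

theorem add_intProj_mem_singularSet {p : P} {z : A → ℤ} :
    p + intProj π z ∈ singularSet π u ↔ p ∈ singularSet π u := by
  simp only [singularSet, mem_iUnion, mem_preimage, add_assoc, ← map_add]
  exact (Equiv.addLeft z).exists_congr_left.trans (by simp)

theorem eq_of_torusMk_eq {p q : P} (hp : p ∈ tile π u) (hq : q ∈ tile π u)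
    (h : torusMk π p = torusMk π q) (hpT : p ∉ translateOverlap π u) : p = q := by
  by_contra hne
  have hmem : p - q ∈ projGamma0 π := by rw [← torusMk_eq_zero, map_sub, h, sub_self]
  have hne0 : (⟨p - q, hmem⟩ : projGamma0 π) ≠ 0 := fun h0 =>
    hne (sub_eq_zero.1 (congrArg Subtype.val h0))
  exact hpT (mem_iUnion₂.2 ⟨_, hne0, hp, q, hq, add_sub_cancel q p⟩)

theorem measurableSet_pieceOverlap [Finite A] : MeasurableSet (pieceOverlap π u) :=
  .iUnion fun a => .iUnion fun b => .iUnion fun _ =>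
    (measurableSet_tilePiece a).inter (measurableSet_tilePiece b)

theorem measurableSet_singularSet [Finite A] : MeasurableSet (singularSet π u) :=
  have := Fintype.ofFinite A
  .iUnion fun _ => measurable_add_const _ measurableSet_pieceOverlap

theorem measurableSet_translateOverlap [Finite A] : MeasurableSet (translateOverlap π u) :=
  have := Fintype.ofFinite A
  .iUnion fun γ => .iUnion fun _ => measurableSet_tile.inter
    ((Homeomorph.addRight (γ : P)).isClosedMap _ isClosed_closure).measurableSet

theorem image_torusMk_tile [Finite A] [CompactSpace (ProjTorus π)] [T2Space (ProjTorus π)]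
    (hdense : DenseRange (intProj π)) (hbdd : IsBounded (intProj π '' discreteLine u)) :
    torusMk π '' tile π u = univ := by
  have := Fintype.ofFinite A
  have hclosed : IsClosed (torusMk π '' tile π u) :=
    ((isCompact_tile hbdd).image (continuous_torusMk π)).isClosed
  rw [← hclosed.closure_eq, ← dense_iff_closure_eq]
  refine (denseRange_nsmul_torusMk hdense (u 0)).mono (range_subset_iff.2 fun n => ?_)
  refine ⟨_, subset_closure ⟨_, ⟨n, rfl⟩, rfl⟩, ?_⟩
  rw [torusMk_intProj (u 0), sum_abelianVector_wordPrefix, natCast_zsmul]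

variable [Fintype A]

theorem volume_singularSet
    (hdisj : ∀ a b : A, a ≠ b → volume (tilePiece π u a ∩ tilePiece π u b) = 0) :
    volume (singularSet π u) = 0 := by
  simpa only [singularSet, pieceOverlap, measure_iUnion_null_iff, measure_preimage_add_right,
    forall_const] using hdisj

theorem volume_translateOverlap
    (h : ∀ s ∈ projGamma0 π, ∀ t ∈ projGamma0 π, s ≠ t →
      volume (((fun x => x + s) '' tile π u) ∩ ((fun x => x + t) '' tile π u)) = 0) :
    volume (translateOverlap π u) = 0 := by
  simp only [translateOverlap, measure_iUnion_null_iff]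
  intro γ hγ
  simpa only [add_zero, image_id'] using h 0 (zero_mem _) γ γ.2 fun h0 => hγ (Subtype.ext h0.symm)

variable [CompactSpace (ProjTorus π)] [T2Space (ProjTorus π)]

theorem volume_tile_ne_zero (hdense : DenseRange (intProj π))
    (hbdd : IsBounded (intProj π '' discreteLine u)) : volume (tile π u) ≠ 0 := fun h => by
  have huniv := measure_preimage_image_eq_zero (p := torusMk π) h
  rw [image_torusMk_tile hdense hbdd, preimage_univ] at huniv
  exact NeZero.ne _ huniv

theorem torusMeasure_image_eq_zero {N : Set P} (hN : volume N = 0) :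
    torusMeasure π (torusMk π '' N) = 0 :=
  measure_image_eq_zero_of_countable_ker (continuous_torusMk π).measurable (surjective_torusMk π) hN

end Tile

/-! ### The domain exchange -/

section DomainExchange

variable {A : Type*} [Fintype A] [DecidableEq A] {P : Submodule ℝ (EuclideanSpace ℝ A)}
  {π : EuclideanSpace ℝ A →ₗ[ℝ] P} {u : ℕ → A}

theorem coe_domainExchange {x : tile π u} {a : A} (ha : (x : P) ∈ tilePiece π u a)
    (hx : (x : P) ∉ pieceOverlap π u) :
    (domainExchange π u x : P) = x + intProj π (basisVec a) := by
  have h : ∃! a : A, (x : P) ∈ tilePiece π u a :=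
    ⟨a, ha, fun b hb => eq_of_mem_tilePiece hx hb ha⟩
  rw [domainExchange, dif_pos h]
  simp only [eq_of_mem_tilePiece hx h.choose_spec.1 ha]

theorem domainExchange_of_mem {x : tile π u} (hx : (x : P) ∈ pieceOverlap π u) :
    domainExchange π u x = x := by
  have h : ¬ ∃! a : A, (x : P) ∈ tilePiece π u a := by
    rintro ⟨c, -, hc⟩
    simp only [pieceOverlap, mem_iUnion] at hx
    obtain ⟨a, b, hab, ha, hb⟩ := hx
    exact hab ((hc a ha).trans (hc b hb).symm)
  rw [domainExchange, dif_neg h]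

theorem measurable_domainExchange : Measurable (domainExchange π u) := by
  have hcoe : MeasurableEmbedding (Subtype.val : tile π u → P) := .subtype_coe measurableSet_tile
  refine fun s hs => ?_
  have hpre : domainExchange π u ⁻¹' s = ((↑) ⁻¹' pieceOverlap π u ∩ s) ∪ ⋃ a : A,
      (↑) ⁻¹' ((tilePiece π u a \ pieceOverlap π u) ∩
        (· + intProj π (basisVec a)) ⁻¹' ((↑) '' s)) := by
    ext x
    simp only [mem_preimage, mem_union, mem_inter_iff, mem_iUnion, Set.mem_sdiff]
    by_cases hx : (x : P) ∈ pieceOverlap π u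
    · simp only [hx, domainExchange_of_mem hx, true_and, not_true, and_false, false_and,
        exists_false, or_false]
    · obtain ⟨a, ha⟩ := mem_iUnion.1 (iUnion_tilePiece.ge x.2)
      simp only [hx, false_and, false_or, not_false_eq_true, and_true]
      refine ⟨fun h => ⟨a, ha, _, h, coe_domainExchange ha hx⟩, ?_⟩
      rintro ⟨b, hb, y, hy, hyx⟩
      rwa [Subtype.ext ((coe_domainExchange hb hx).trans hyx.symm)]
  rw [hpre]
  refine ((hcoe.measurable measurableSet_pieceOverlap).inter hs).union (.iUnion fun a => ?_)
  exact hcoe.measurable (((measurableSet_tilePiece a).diff measurableSet_pieceOverlap).inter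
    (measurable_add_const _ (hcoe.measurableSet_image.2 hs)))

theorem tileMeasure_apply (s : Set (tile π u)) :
    tileMeasure π u s = (volume (tile π u))⁻¹ * volume ((↑) '' s : Set P) := by
  rw [tileMeasure, Measure.smul_apply, smul_eq_mul,
    (MeasurableEmbedding.subtype_coe measurableSet_tile).comap_apply]

theorem tileMeasure_preimage_eq_zero {N : Set P} (hN : volume N = 0) :
    tileMeasure π u ((↑) ⁻¹' N) = 0 := by
  rw [tileMeasure_apply, measure_mono_null (image_preimage_subset _ _) hN, mul_zero]

theorem isProbabilityMeasure_tileMeasure (hbdd : IsBounded (intProj π '' discreteLine u))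
    (h0 : volume (tile π u) ≠ 0) : IsProbabilityMeasure (tileMeasure π u) :=
  ⟨by rw [tileMeasure_apply, image_univ, Subtype.range_coe,
    ENNReal.inv_mul_cancel h0 (isCompact_tile hbdd).measure_ne_top]⟩

/-- The translated pieces cover the tile, so the domain exchange cannot shrink preimages; as the
total mass is finite, it preserves the measure. -/
theorem measurePreserving_domainExchange [IsFiniteMeasure (tileMeasure π u)]
    (hdisj : ∀ a b : A, a ≠ b → volume (tilePiece π u a ∩ tilePiece π u b) = 0)
    (hcover : tile π u ⊆ ⋃ a, (· + intProj π (basisVec a)) '' tilePiece π u a) :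
    MeasurePreserving (domainExchange π u) (tileMeasure π u) (tileMeasure π u) := by
  refine measurePreserving_of_le_measure_preimage measurable_domainExchange fun s hs => ?_
  rw [tileMeasure_apply, tileMeasure_apply]
  gcongr _ * ?_
  refine measure_le_of_ae_le_iUnion_image_add (B := fun a => tilePiece π u a \ pieceOverlap π u)
    (fun a => (measurableSet_tilePiece a).diff measurableSet_pieceOverlap)
    pairwise_disjoint_sdiff_pieceOverlap (fun a => intProj π (basisVec a))
    ((MeasurableEmbedding.subtype_coe measurableSet_tile).measurableSet_image.2
      (measurable_domainExchange hs)) ?_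
  filter_upwards [measure_eq_zero_iff_ae_notMem.1 (volume_singularSet hdisj)]
  rintro p hp ⟨x, hx, rfl⟩
  obtain ⟨a, q, hq, hqx⟩ := mem_iUnion.1 (hcover x.2)
  have hqo : q ∉ pieceOverlap π u := fun h =>
    hp (hqx ▸ add_intProj_mem_singularSet.2 (pieceOverlap_subset_singularSet h))
  let y : tile π u := ⟨q, tilePiece_subset_tile a hq⟩
  have hyx : domainExchange π u y = x := Subtype.ext ((coe_domainExchange hq hqo).trans hqx)
  exact mem_iUnion.2 ⟨a, q, ⟨⟨hq, hqo⟩, y, by rwa [mem_preimage, hyx], rfl⟩, hqx⟩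

end DomainExchange

/-! ### The position map -/

section Subshift

variable {A : Type*} [TopologicalSpace A] {u : ℕ → A}

instance [Finite A] : CompactSpace (subshift u) :=
  isCompact_iff_compactSpace.1 isClosed_closure.isCompact

/-- The word `u` as a point of its subshift, the origin from which positions are measured. -/
def basePoint (u : ℕ → A) : subshift u := ⟨u, subset_closure ⟨0, rfl⟩⟩

instance : Nonempty (subshift u) := ⟨basePoint u⟩

theorem continuous_subshiftMap : Continuous (subshiftMap u) :=
  continuous_shift.restrict _

theorem coe_subshiftMap_iterate (x : subshift u) (n : ℕ) :
    ((subshiftMap u)^[n] x : ℕ → A) = shift^[n] (x : ℕ → A) :=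
  (Semiconj.iterate_right (f := Subtype.val) (fun _ => rfl) n) x

theorem subshiftMap_iterate_apply_zero (x : subshift u) (n : ℕ) :
    ((subshiftMap u)^[n] x).1 0 = x.1 n := by
  rw [coe_subshiftMap_iterate, shift_iterate_apply, zero_add]

theorem denseRange_iterate_basePoint : DenseRange fun n => (subshiftMap u)^[n] (basePoint u) := by
  rw [DenseRange, Subtype.dense_iff, ← range_comp]
  refine closure_mono ?_
  rintro _ ⟨n, rfl⟩
  exact ⟨n, coe_subshiftMap_iterate _ _⟩

theorem continuous_apply_zero : Continuous fun x : subshift u => x.1 0 :=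
  (continuous_apply 0).comp continuous_subtype_val

variable [DecidableEq A] {P : Submodule ℝ (EuclideanSpace ℝ A)}

/-- A position map: it places the points of the subshift continuously in the hyperplane, `u` at the
origin, so that reading a letter `a` moves the position by `π(e_a)`. -/
structure IsPositionMap (π : EuclideanSpace ℝ A →ₗ[ℝ] P) (u : ℕ → A) (g : subshift u → P) :
    Prop where
  continuous : Continuous g
  apply_basePoint : g (basePoint u) = 0
  apply_subshiftMap : ∀ x, g (subshiftMap u x) = g x + intProj π (basisVec (x.1 0))

variable {π : EuclideanSpace ℝ A →ₗ[ℝ] P}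

theorem birkhoffSum_basisVec (n : ℕ) :
    birkhoffSum (subshiftMap u) (fun x => intProj π (basisVec (x.1 0))) n (basePoint u) =
      intProj π (abelianVector (wordPrefix u n)) := by
  induction n with
  | zero => exact (map_zero (intProj π)).symm
  | succ n ih =>
    rw [birkhoffSum_succ, ih, subshiftMap_iterate_apply_zero, abelianVector_wordPrefix_succ,
      map_add, basePoint]

theorem exists_isPositionMap [Finite A] [DiscreteTopology A]
    (hbdd : IsBounded (intProj π '' discreteLine u)) (hmin : IsMinimalSystem (subshiftMap u)) :
    ∃ g, IsPositionMap π u g := by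
  have := Fintype.ofFinite A
  have hf : Continuous fun x : subshift u => intProj π (basisVec (x.1 0)) :=
    (continuous_of_discreteTopology (f := fun a : A => intProj π (basisVec a))).comp
      continuous_apply_zero
  have hb : IsBounded (range fun n => birkhoffSum (subshiftMap u)
      (fun x => intProj π (basisVec (x.1 0))) n (basePoint u)) := by
    simpa only [birkhoffSum_basisVec, discreteLine_eq_range, ← range_comp, comp_def] using hbdd
  obtain ⟨g, hg, hgS⟩ := hmin.exists_continuous_coboundary continuous_subshiftMap hf hb
  exact ⟨fun x => g x - g (basePoint u), hg.sub continuous_const, sub_self _, fun x => by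
    rw [hgS, sub_add_eq_add_sub]⟩

namespace IsPositionMap

variable {g : subshift u → P} (hg : IsPositionMap π u g)
include hg

theorem apply_iterate_basePoint (n : ℕ) :
    g ((subshiftMap u)^[n] (basePoint u)) = intProj π (abelianVector (wordPrefix u n)) := by
  rw [← birkhoffSum_basisVec]
  induction n with
  | zero => rw [birkhoffSum_zero, iterate_zero_apply, hg.apply_basePoint]
  | succ n ih => rw [iterate_succ_apply', hg.apply_subshiftMap, ih, birkhoffSum_succ]

theorem range_eq_tile [Finite A] : range g = tile π u := by
  have hline : intProj π '' discreteLine u =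
      g '' range fun n => (subshiftMap u)^[n] (basePoint u) := by
    simp only [discreteLine_eq_range, ← range_comp, comp_def, hg.apply_iterate_basePoint]
  refine Subset.antisymm ?_ ?_
  · rw [tile, hline, ← image_univ, ← denseRange_iterate_basePoint.closure_range]
    exact image_closure_subset_closure_image hg.continuous
  · rw [tile, hline]
    exact closure_minimal (image_subset_range _ _) (isCompact_range hg.continuous).isClosed

theorem mem_tilePiece [DiscreteTopology A] (x : subshift u) : g x ∈ tilePiece π u (x.1 0) := by
  have hopen : IsOpen {y : subshift u | y.1 0 = x.1 0} :=
    (isOpen_discrete {x.1 0}).preimage continuous_apply_zero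
  have hx := denseRange_iterate_basePoint.open_subset_closure_inter hopen (rfl : x.1 0 = x.1 0)
  refine closure_mono ?_ (image_closure_subset_closure_image hg.continuous (mem_image_of_mem g hx))
  rintro _ ⟨_, ⟨hn, n, rfl⟩, rfl⟩
  refine ⟨_, mem_discretePiece.2 ⟨n, ?_, rfl⟩, (hg.apply_iterate_basePoint n).symm⟩
  exact (subshiftMap_iterate_apply_zero (basePoint u) n).symm.trans hn

theorem mem_tile [DiscreteTopology A] (x : subshift u) : g x ∈ tile π u :=
  tilePiece_subset_tile _ (hg.mem_tilePiece x)

theorem tile_subset_iUnion_image_add [Finite A] [DiscreteTopology A]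
    (hmin : IsMinimalSystem (subshiftMap u)) :
    tile π u ⊆ ⋃ a, (· + intProj π (basisVec a)) '' tilePiece π u a := by
  rw [← hg.range_eq_tile]
  rintro _ ⟨x, rfl⟩
  obtain ⟨y, rfl⟩ := hmin.surjective continuous_subshiftMap x
  exact mem_iUnion.2 ⟨_, _, hg.mem_tilePiece y, (hg.apply_subshiftMap y).symm⟩

/-- Off the singular set, the pieces visited by the positions of the iterates spell the word. -/
theorem injOn [DiscreteTopology A] : InjOn g (g ⁻¹' (singularSet π u)ᶜ) := by
  intro x hx y _ hxy
  have hletter {x y : subshift u} (hx : g x ∉ singularSet π u) (hxy : g x = g y) :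
      x.1 0 = y.1 0 :=
    eq_of_mem_tilePiece (fun h => hx (pieceOverlap_subset_singularSet h)) (hg.mem_tilePiece x)
      (hxy ▸ hg.mem_tilePiece y)
  have horbit (n : ℕ) : g ((subshiftMap u)^[n] x) ∉ singularSet π u ∧
      g ((subshiftMap u)^[n] x) = g ((subshiftMap u)^[n] y) := by
    induction n with
    | zero => exact ⟨hx, hxy⟩
    | succ n ih =>
      rw [iterate_succ_apply', iterate_succ_apply', hg.apply_subshiftMap, hg.apply_subshiftMap,
        ← hletter ih.1 ih.2, ← ih.2, add_intProj_mem_singularSet]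
      exact ⟨ih.1, rfl⟩
  refine Subtype.ext (funext fun n => ?_)
  rw [← subshiftMap_iterate_apply_zero x, ← subshiftMap_iterate_apply_zero y]
  exact hletter (horbit n).1 (horbit n).2

theorem torusMk_apply_subshiftMap (a : A) (x : subshift u) :
    torusMk π (g (subshiftMap u x)) = torusTranslation π a (torusMk π (g x)) := by
  rw [hg.apply_subshiftMap, map_add, torusMk_basisVec π _ a, torusTranslation]

theorem isTopSemiconjugacy [Finite A] [CompactSpace (ProjTorus π)] [T2Space (ProjTorus π)]
    (hdense : DenseRange (intProj π)) (hbdd : IsBounded (intProj π '' discreteLine u)) (a : A) :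
    IsTopSemiconjugacy (subshiftMap u) (torusTranslation π a) fun x => torusMk π (g x) where
  continuous := (continuous_torusMk π).comp hg.continuous
  surjective := range_eq_univ.1 <| by
    have := Fintype.ofFinite A
    rw [range_comp' (torusMk π) g, hg.range_eq_tile, image_torusMk_tile hdense hbdd]
  semiconj := hg.torusMk_apply_subshiftMap a

theorem encard_fiber [Finite A] [DiscreteTopology A] {y : ProjTorus π}
    (hy : y ∉ torusMk π '' singularSet π u) :
    ((fun x => torusMk π (g x)) ⁻¹' {y}).encard = (tile π u ∩ torusMk π ⁻¹' {y}).encard := by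
  have himage : g '' ((fun x => torusMk π (g x)) ⁻¹' {y}) = tile π u ∩ torusMk π ⁻¹' {y} := by
    rw [← hg.range_eq_tile, inter_comm, ← image_preimage_eq_inter_range, preimage_preimage]
  have hinj : InjOn g ((fun x => torusMk π (g x)) ⁻¹' {y}) :=
    hg.injOn.mono fun _ hx h => hy ⟨_, h, hx⟩
  rw [← himage, hinj.encard_image]

theorem encard_fiber_torusTranslation_le [Finite A] [DiscreteTopology A]
    (hmin : IsMinimalSystem (subshiftMap u)) (a : A) (y : ProjTorus π) :
    ((fun x => torusMk π (g x)) ⁻¹' {torusTranslation π a y}).encard ≤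
      ((fun x => torusMk π (g x)) ⁻¹' {y}).encard := by
  refine (encard_le_encard fun x hx => ?_).trans (encard_image_le (subshiftMap u) _)
  obtain ⟨x', rfl⟩ := hmin.surjective continuous_subshiftMap x
  exact ⟨x', add_right_cancel ((hg.torusMk_apply_subshiftMap a x').symm.trans hx), rfl⟩

end IsPositionMap

end Subshift

/-! ### Invariant measures -/

namespace IsPositionMap

variable {A : Type*} [TopologicalSpace A] [DiscreteTopology A] [Fintype A] [DecidableEq A]
  {u : ℕ → A} {P : Submodule ℝ (EuclideanSpace ℝ A)}
  {π : EuclideanSpace ℝ A →ₗ[ℝ] P} {g : subshift u → P} (hg : IsPositionMap π u g)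
include hg

theorem aemeasurable_encard_fiber [CompactSpace (ProjTorus π)] [T2Space (ProjTorus π)]
    (hdisj : ∀ a b : A, a ≠ b → volume (tilePiece π u a ∩ tilePiece π u b) = 0) :
    AEMeasurable (fun y => ((fun x => torusMk π (g x)) ⁻¹' {y}).encard) (torusMeasure π) := by
  refine ⟨_, measurable_encard_inter_fiber (continuous_torusMk π).measurable
    (surjective_torusMk π) (measurableSet_tile (π := π) (u := u)), ?_⟩
  filter_upwards [measure_eq_zero_iff_ae_notMem.1 (torusMeasure_image_eq_zero
    (volume_singularSet hdisj))] with y hy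
  exact hg.encard_fiber hy

variable [MeasurableSpace A] [BorelSpace A]

theorem exists_measurablyIsomorphic_domainExchange (hmin : IsMinimalSystem (subshiftMap u))
    [IsProbabilityMeasure (tileMeasure π u)]
    (hdisj : ∀ a b : A, a ≠ b → volume (tilePiece π u a ∩ tilePiece π u b) = 0) :
    ∃ μ : Measure (subshift u), IsProbabilityMeasure μ ∧
      MeasurablyIsomorphic (subshiftMap u) μ (domainExchange π u) (tileMeasure π u) := by
  let G : subshift u → tile π u := fun x => ⟨g x, hg.mem_tile x⟩
  let t : Set (tile π u) := (↑) ⁻¹' (singularSet π u)ᶜ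
  have hG : Continuous G := hg.continuous.subtype_mk _
  have hsurj (p : tile π u) : ∃ x, G x = p := by
    obtain ⟨x, hx⟩ := hg.range_eq_tile.ge p.2
    exact ⟨x, Subtype.ext hx⟩
  obtain ⟨ψ, hψ, hinv⟩ := exists_measurable_invOn hG.isClosedMap
    (measurable_subtype_coe measurableSet_singularSet.compl : MeasurableSet t)
    (fun p _ => hsurj p) fun x hx y hy hxy => hg.injOn hx hy (congrArg Subtype.val hxy)
  have ht : ∀ᵐ p ∂tileMeasure π u, p ∈ t :=
    measure_eq_zero_iff_ae_notMem.1 (tileMeasure_preimage_eq_zero (volume_singularSet hdisj))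
  have hGμ := measurePreserving_map_of_rightInvOn hG.measurable hψ hinv.2 ht
  have hsemi : ∀ᵐ x ∂(tileMeasure π u).map ψ, G (subshiftMap u x) = domainExchange π u (G x) := by
    filter_upwards [hGμ.quasiMeasurePreserving.ae ht] with x hx
    refine Subtype.ext ((hg.apply_subshiftMap x).trans ?_)
    rw [coe_domainExchange (hg.mem_tilePiece x) fun h => hx (pieceOverlap_subset_singularSet h)]
  exact ⟨_, Measure.isProbabilityMeasure_map hψ.aemeasurable, measurablyIsomorphic_of_invOn
    continuous_subshiftMap.measurable
    (measurePreserving_domainExchange hdisj (hg.tile_subset_iUnion_image_add hmin)) hGμ hψ hinv ht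
    hsemi⟩

variable [CompactSpace (ProjTorus π)] [T2Space (ProjTorus π)]

theorem measurePreserving_torusMk (hdense : DenseRange (intProj π)) {ν : Measure (subshift u)}
    [IsProbabilityMeasure ν] (hν : MeasurePreserving (subshiftMap u) ν ν) :
    MeasurePreserving (fun x => torusMk π (g x)) ν (torusMeasure π) :=
  measurePreserving_of_semiconj_add_right (denseRange_nsmul_torusMk hdense (u 0))
    ((continuous_torusMk π).comp hg.continuous).measurable hν
    (.of_forall (hg.torusMk_apply_subshiftMap (u 0)))

theorem isFiniteExtension (hdense : DenseRange (intProj π))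
    (hbdd : IsBounded (intProj π '' discreteLine u)) (hmin : IsMinimalSystem (subshiftMap u))
    (hdisj : ∀ a b : A, a ≠ b → volume (tilePiece π u a ∩ tilePiece π u b) = 0)
    (hfin : ∀ y, (tile π u ∩ torusMk π ⁻¹' {y}).Finite) {μ : Measure (subshift u)}
    [IsProbabilityMeasure μ] (hμ : MeasurePreserving (subshiftMap u) μ μ) (a : A) :
    IsFiniteExtension (subshiftMap u) μ (torusTranslation π a) (torusMeasure π)
      fun x => torusMk π (g x) := by
  have hT := ergodic_torusTranslation hdense a
  refine ⟨hμ, hT.toMeasurePreserving, hg.measurePreserving_torusMk hdense hμ,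
    .of_forall (hg.torusMk_apply_subshiftMap a), ?_⟩
  have : OpensMeasurableSpace ℕ∞ := ⟨fun _ _ => .of_discrete⟩
  obtain ⟨k, hk⟩ := exists_ae_eq_const_of_comp_ae_le hT (hg.aemeasurable_encard_fiber hdisj)
    (.of_forall (hg.encard_fiber_torusTranslation_le hmin a))
  obtain ⟨y, hy, hys⟩ := (hk.and (measure_eq_zero_iff_ae_notMem.1 (torusMeasure_image_eq_zero
    (volume_singularSet hdisj)))).exists
  have hktop : k ≠ ⊤ := by
    rw [← hy, hg.encard_fiber hys]
    exact (hfin y).encard_lt_top.ne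
  lift k to ℕ using hktop
  refine ⟨k, ?_, hk⟩
  rw [← Nat.one_le_cast (α := ℕ∞), ← hy, one_le_encard_iff_nonempty]
  exact (hg.isTopSemiconjugacy hdense hbdd a).surjective y

theorem exists_measurable_invOn_torusMk (hdense : DenseRange (intProj π))
    (hbdd : IsBounded (intProj π '' discreteLine u))
    (hdisj : ∀ a b : A, a ≠ b → volume (tilePiece π u a ∩ tilePiece π u b) = 0)
    (hover : volume (translateOverlap π u) = 0) :
    ∃ (ψ : ProjTorus π → subshift u) (t : Set (ProjTorus π)), Measurable ψ ∧
      InvOn ψ (fun x => torusMk π (g x)) ((fun x => torusMk π (g x)) ⁻¹' t) t ∧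
      ∀ᵐ y ∂torusMeasure π, y ∈ t := by
  let N := singularSet π u ∪ translateOverlap π u
  have hN : MeasurableSet (torusMk π '' N) := measurableSet_image_of_countable_ker
    (continuous_torusMk π).measurable (surjective_torusMk π)
    (measurableSet_singularSet.union measurableSet_translateOverlap)
  have hφ : Continuous fun x => torusMk π (g x) := (continuous_torusMk π).comp hg.continuous
  obtain ⟨ψ, hψ, hinv⟩ := exists_measurable_invOn hφ.isClosedMap hN.compl
    (fun y _ => (hg.isTopSemiconjugacy hdense hbdd (u 0)).surjective y) fun x hx y hy hxy => by
      refine hg.injOn (fun h => hx ⟨_, .inl h, rfl⟩) (fun h => hy ⟨_, .inl h, rfl⟩) ?_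
      exact eq_of_torusMk_eq (hg.mem_tile x) (hg.mem_tile y) hxy fun h => hx ⟨_, .inr h, rfl⟩
  exact ⟨ψ, _, hψ, hinv, measure_eq_zero_iff_ae_notMem.1
    (torusMeasure_image_eq_zero (measure_union_null (volume_singularSet hdisj) hover))⟩

theorem isUniquelyErgodic_and_measurablyIsomorphic (hdense : DenseRange (intProj π))
    (hbdd : IsBounded (intProj π '' discreteLine u))
    (hdisj : ∀ a b : A, a ≠ b → volume (tilePiece π u a ∩ tilePiece π u b) = 0)
    (hover : volume (translateOverlap π u) = 0) {μ : Measure (subshift u)}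
    [IsProbabilityMeasure μ] (hμ : MeasurePreserving (subshiftMap u) μ μ) :
    IsUniquelyErgodic (subshiftMap u) ∧ ∀ a : A,
      MeasurablyIsomorphic (subshiftMap u) μ (torusTranslation π a) (torusMeasure π) := by
  obtain ⟨ψ, t, hψ, hinv, ht⟩ := hg.exists_measurable_invOn_torusMk hdense hbdd hdisj hover
  have hmap (ν : Measure (subshift u)) [IsProbabilityMeasure ν]
      (hν : MeasurePreserving (subshiftMap u) ν ν) : (torusMeasure π).map ψ = ν :=
    (measurePreserving_of_leftInvOn (hg.measurePreserving_torusMk hdense hν) hψ hinv.1 ht).map_eq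
  refine ⟨⟨μ, ⟨inferInstance, hμ⟩, fun ν ⟨_, hν⟩ => (hmap ν hν).symm.trans (hmap μ hμ)⟩,
    fun a => ?_⟩
  exact measurablyIsomorphic_of_invOn hμ.measurable
    (ergodic_torusTranslation hdense a).toMeasurePreserving
    (hg.measurePreserving_torusMk hdense hμ) hψ hinv ht
    (.of_forall (hg.torusMk_apply_subshiftMap a))

end IsPositionMap

end

theorem mainTheorem2_general {A : Type*} [Fintype A] [DecidableEq A] [TopologicalSpace A]
    [DiscreteTopology A] [MeasurableSpace A] [BorelSpace A] (u : ℕ → A)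
    (P : Submodule ℝ (EuclideanSpace ℝ A)) (hP : Module.finrank ℝ P + 1 = Fintype.card A)
    (π : EuclideanSpace ℝ A →ₗ[ℝ] P) (hdense : DenseRange (intProj π))
    (hbdd : Bornology.IsBounded (intProj π '' discreteLine u))
    (hmin : IsMinimalSystem (subshiftMap u))
    (hdisj : ∀ a b : A, a ≠ b → volume (tilePiece π u a ∩ tilePiece π u b) = 0) :
    ∃ μ : Measure (subshift u), IsProbabilityMeasure μ ∧
      MeasurePreserving (subshiftMap u) μ μ ∧
      IsProbabilityMeasure (torusMeasure π) ∧
      MeasurablyIsomorphic (subshiftMap u) μ (domainExchange π u) (tileMeasure π u) ∧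
      (∃ φ : subshift u → ProjTorus π, ∀ a : A,
        IsFiniteExtension (subshiftMap u) μ (torusTranslation π a) (torusMeasure π) φ ∧
        IsTopSemiconjugacy (subshiftMap u) (torusTranslation π a) φ) ∧
      ((∀ s ∈ projGamma0 π, ∀ t ∈ projGamma0 π, s ≠ t →
          volume (((fun x => x + s) '' tile π u) ∩ ((fun x => x + t) '' tile π u)) = 0) →
        IsUniquelyErgodic (subshiftMap u) ∧
        ∀ a : A, MeasurablyIsomorphic (subshiftMap u) μ
          (torusTranslation π a) (torusMeasure π)) := by
  obtain ⟨b, hb⟩ := exists_basis_projGamma0 hP (surjective_of_denseRange_intProj hdense) hbdd (u 0)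
  have := t2Space_projTorus b hb
  have := compactSpace_projTorus b hb
  have := isProbabilityMeasure_tileMeasure hbdd (volume_tile_ne_zero hdense hbdd)
  obtain ⟨g, hg⟩ := exists_isPositionMap hbdd hmin
  obtain ⟨μ, _, hiso⟩ := hg.exists_measurablyIsomorphic_domainExchange hmin hdisj
  have hfin := finite_inter_fiber_torusMk b hb (isCompact_tile hbdd).isBounded
  exact ⟨μ, inferInstance, hiso.1, inferInstance, hiso, ⟨_, fun a =>
    ⟨hg.isFiniteExtension hdense hbdd hmin hdisj hfin hiso.1 a,
      hg.isTopSemiconjugacy hdense hbdd a⟩⟩, fun htrans =>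
    hg.isUniquelyErgodic_and_measurablyIsomorphic hdense hbdd hdisj
      (volume_translateOverlap htrans) hiso.1⟩

theorem mainTheorem2 {A : Type*} [Fintype A] [DecidableEq A]
    [TopologicalSpace A] [DiscreteTopology A] [MeasurableSpace A] [BorelSpace A]
    (u : ℕ → A)
    (P : Submodule ℝ (EuclideanSpace ℝ A)) (hP : Module.finrank ℝ P + 1 = Fintype.card A)
    (π : EuclideanSpace ℝ A →ₗ[ℝ] P) (hπ : ∀ x : P, π x = x)
    (hdense : DenseRange (intProj π))
    (hbdd : Bornology.IsBounded (intProj π '' discreteLine u))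
    (hmin : IsMinimalSystem (subshiftMap u))
    (hfrontier : ∀ a : A, volume (frontier (tilePiece π u a)) = 0)
    (hdisj : ∀ a b : A, a ≠ b → volume (tilePiece π u a ∩ tilePiece π u b) = 0) :
    ∃ μ : Measure (subshift u), IsProbabilityMeasure μ ∧
      MeasurePreserving (subshiftMap u) μ μ ∧
      IsProbabilityMeasure (torusMeasure π) ∧
      (∃ φ : subshift u → ProjTorus π, ∀ a : A,
        IsFiniteExtension (subshiftMap u) μ (torusTranslation π a) (torusMeasure π) φ ∧
        IsTopSemiconjugacy (subshiftMap u) (torusTranslation π a) φ) ∧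
      ((∀ s ∈ projGamma0 π, ∀ t ∈ projGamma0 π, s ≠ t →
          volume (((fun x => x + s) '' tile π u) ∩ ((fun x => x + t) '' tile π u)) = 0) →
        IsUniquelyErgodic (subshiftMap u) ∧
        (∀ a : A, MeasurablyIsomorphic (subshiftMap u) μ
          (torusTranslation π a) (torusMeasure π)) ∧
        MeasurablyIsomorphic (subshiftMap u) μ (domainExchange π u) (tileMeasure π u)) := by
  obtain ⟨μ, hμ, hS, hm, hE, hφ, htrans⟩ :=
    mainTheorem2_general u P hP π hdense hbdd hmin hdisj
  exact ⟨μ, hμ, hS, hm, hφ, fun h => ⟨(htrans h).1, (htrans h).2, hE⟩⟩
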